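/- Let $n\ge 0$ be an integer. A Rogers–Ramanujan partition is a partition in which any two parts (as members of the multiset of parts) differ by at least $2$ (the empty partition, and any partition with a single part, is included). A chain of a Rogers–Ramanujan partition is a maximal nonempty block of its parts of the form $a, a+2, \dots, a+2(\ell-1)$ with $\ell\ge 1$; all parts of a chain have the same parity, and the chain is called even if its parts are even. For a partition $\pi$ let $\nu_3(\pi)$ be the number of parts of $\pi$ that are divisible by $3$, counted with multiplicity, and for a Rogers–Ramanujan partition $\tilde\pi$ let $r(\tilde\pi)$ be the number of its even chains. Then $$\sum_{\pi}(-1)^{\nu_3(\pi)}=\sum_{\tilde\pi}2^{r(\tilde\pi)},$$ where $\pi$ runs over all (unrestricted) partitions of $n$ and $\tilde\pi$ runs over all Rogers–Ramanujan partitions of $n$. -/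

import Mathlib

/-- Rogers–Ramanujan partitions: any two parts differ by at least `2`
(so there are no repeated parts). -/
def IsRogersRamanujan {n : ℕ} (p : n.Partition) : Prop :=
  p.parts.Nodup ∧ ∀ a ∈ p.parts, ∀ b ∈ p.parts, a < b → a + 2 ≤ b

/-- The block `{a, a + 2, …, a + 2 (l - 1)}` of `l` numbers, consecutive ones differing by `2`. -/
def stepTwoBlock (a l : ℕ) : Finset ℕ :=
  (Finset.range l).image fun i => a + 2 * i

/-- `C` is a nonempty block of parts of `p` in which consecutive elements differ by `2`. -/
def IsBlockOf {n : ℕ} (p : n.Partition) (C : Finset ℕ) : Prop :=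
  C ⊆ p.parts.toFinset ∧ ∃ a l : ℕ, 1 ≤ l ∧ C = stepTwoBlock a l

/-- A chain: a maximal (for inclusion) block of parts differing by `2`. -/
def IsChainOf {n : ℕ} (p : n.Partition) (C : Finset ℕ) : Prop :=
  Maximal (IsBlockOf p) C

open Classical in
/-- The finite set of all chains of `p`. -/
noncomputable def chains {n : ℕ} (p : n.Partition) : Finset (Finset ℕ) :=
  p.parts.toFinset.powerset.filter (IsChainOf p)

open Classical in
/-- The number of even chains of `p`, that is, chains all of whose parts are even. -/
noncomputable def numEvenChains {n : ℕ} (p : n.Partition) : ℕ :=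
  ((chains p).filter fun C => ∀ m ∈ C, Even m).card

/-- The number of parts of `p` divisible by `3`, counted with multiplicity. -/
def numMultiplesOfThree {n : ℕ} (p : n.Partition) : ℕ :=
  p.parts.countP fun m => 3 ∣ m

open Classical in
/-- The finite set of Rogers–Ramanujan partitions of `n`. -/
noncomputable def rogersRamanujanPartitions (n : ℕ) : Finset n.Partition :=
  Finset.univ.filter fun p => IsRogersRamanujan p

/-! Both sides have generating function $\theta(q^3)/(q;q)_\infty$, where
$\theta(q)=\sum_r(-1)^rq^{r^2}=(q;q^2)_\infty^2(q^2;q^2)_\infty$.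

Signed side: flipping the sign at multiples of $3$ gives
$(q^3;q^3)_\infty/\bigl((q;q)_\infty(-q^3;q^3)_\infty\bigr)$. Euler's identity
$(q^3;q^6)_\infty(-q^3;q^3)_\infty=1$ turns this into the quotient above
(`genFun_threeSign_eq_gapSeries`).

Chain side: an even chain is recorded by its first part. Deciding whether the smallest allowed
integer $m$ is a part gives two coupled recurrences in $m$, according to whether $m$ may start a new
chain. Together with the value $1$ modulo $q^m$, they determine the generating functions. The series
$C_{i,j}=\sum_k q^{k^2+2ik}\frac{(-q;q^2)_k}{(q^2;q^2)_k}(-q^{2k+2j};q^2)_\infty$ satisfy contiguous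
relations (`chainSeries_self`, `chainSeries_succ`) that yield the same recurrences, so the weighted
count is $C_{0,1}$ (`X_pow_dvd_gapSeries_sub_gapPoly`).

Bridge: $C_{0,1}=(-q^2;q^2)_\infty\sum_k(-q;q^2)_kq^{k^2}/(q^4;q^4)_k$. Here
$1/(q^4;q^4)_k=\sum_r(-1)^rq^{2r^2}/\bigl((q^2;q^2)_{k-r}(q^2;q^2)_{k+r}\bigr)$ is one half of a
Bailey pair. A Bailey transform, resting on a $q$-Chu–Vandermonde sum (`chuSum_eq`), raises the
exponent $2r^2$ to $3r^2$ and produces $\theta(q^3)$ (`chainSeries_zero_one_mul_qPoch`). The finite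
identities are proved by telescoping, and their limits are taken as congruences modulo $X^N$. -/

open scoped PowerSeries.WithPiTopology
open PowerSeries (X)
open PowerSeries.WithPiTopology Filter Topology

/-! ### Convergence of sums and products of power series through divisibility by powers of $X$. -/

section PowerSeriesConvergence

/-- Divisibility by a power of `X` passes to limits. -/
theorem X_pow_dvd_of_tendsto {ι : Type*} {l : Filter ι} [l.NeBot] {f : ι → PowerSeries ℤ}
    {g : PowerSeries ℤ} {k : ℕ} (hf : Tendsto f l (𝓝 g)) (h : ∀ i, X ^ k ∣ f i) : X ^ k ∣ g := by
  rw [PowerSeries.X_pow_dvd_iff]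
  intro m hm
  have h1 := (tendsto_iff_coeff_tendsto ℤ f l g).1 hf m
  have h2 : (fun i => PowerSeries.coeff m (f i)) = fun _ => 0 := by
    funext i
    exact PowerSeries.X_pow_dvd_iff.1 (h i) m hm
  rw [h2] at h1
  exact tendsto_nhds_unique h1 tendsto_const_nhds

theorem tendsto_order_of_X_pow_dvd {f : ℕ → PowerSeries ℤ} (h : ∀ n, X ^ n ∣ f n) :
    Tendsto (fun n => (f n).order) atTop (𝓝 ⊤) := by
  refine ENat.tendsto_nhds_top_iff_natCast_lt.mpr fun n => eventually_atTop.mpr ⟨n + 1, ?_⟩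
  intro m hm
  have h1 := PowerSeries.X_pow_dvd_iff.1 (h m)
  have h2 : (m : ℕ∞) ≤ (f m).order := PowerSeries.nat_le_order _ _ h1
  refine lt_of_lt_of_le ?_ h2
  exact_mod_cast hm

theorem summable_of_X_pow_dvd {f : ℕ → PowerSeries ℤ} (h : ∀ n, X ^ n ∣ f n) : Summable f :=
  summable_of_tendsto_order_atTop_nhds_top _ (tendsto_order_of_X_pow_dvd h)

theorem multipliable_of_X_pow_dvd {f : ℕ → PowerSeries ℤ} (h : ∀ n, X ^ n ∣ f n - 1) :
    Multipliable f := by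
  have := multipliable_one_add_of_tendsto_order_atTop_nhds_top _ (tendsto_order_of_X_pow_dvd h)
  simpa using this

theorem X_pow_dvd_tsum {f : ℕ → PowerSeries ℤ} {k : ℕ} (hf : Summable f)
    (h : ∀ n, X ^ k ∣ f n) : X ^ k ∣ ∑' n, f n :=
  X_pow_dvd_of_tendsto hf.hasSum fun _ => Finset.dvd_sum fun i _ => h i

theorem dvd_prod_sub_one {ι R : Type*} [CommRing R] {d : R} {f : ι → R} (s : Finset ι)
    (h : ∀ i ∈ s, d ∣ f i - 1) : d ∣ ∏ i ∈ s, f i - 1 := by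
  classical
  induction s using Finset.induction_on with
  | empty => simp
  | insert a s ha ih =>
    rw [Finset.prod_insert ha]
    have h1 := ih fun i hi => h i (Finset.mem_insert_of_mem hi)
    have h2 := h a (Finset.mem_insert_self _ _)
    have : f a * ∏ i ∈ s, f i - 1 = (f a - 1) * ∏ i ∈ s, f i + (∏ i ∈ s, f i - 1) := by ring
    rw [this]
    exact dvd_add (Dvd.dvd.mul_right h2 _) h1

theorem X_pow_dvd_tprod_sub_one {f : ℕ → PowerSeries ℤ} {k : ℕ} (hf : Multipliable f)
    (h : ∀ n, X ^ k ∣ f n - 1) : X ^ k ∣ ∏' n, f n - 1 :=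
  X_pow_dvd_of_tendsto (Tendsto.sub_const hf.hasProd 1) fun s => dvd_prod_sub_one s fun i _ => h i

theorem eq_of_X_pow_dvd_sub {f g : PowerSeries ℤ} (h : ∀ n, X ^ n ∣ f - g) : f = g := by
  ext n
  have := PowerSeries.X_pow_dvd_iff.1 (h (n + 1)) n n.lt_succ_self
  rwa [map_sub, sub_eq_zero] at this

theorem isUnit_of_X_dvd_sub_one {f : PowerSeries ℤ} (h : X ∣ f - 1) : IsUnit f := by
  rw [PowerSeries.isUnit_iff_constantCoeff]
  rw [PowerSeries.X_dvd_iff, map_sub, map_one, sub_eq_zero] at h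
  simp [h]

end PowerSeriesConvergence

/-! ### Infinite $q$-Pochhammer products. -/

section QPochhammer

/-- The infinite `q`-Pochhammer symbol `(y; q)_∞` as a formal power series. -/
noncomputable def qPoch (y q : PowerSeries ℤ) : PowerSeries ℤ := ∏' i : ℕ, (1 - y * q ^ i)

variable {q : PowerSeries ℤ}

theorem multipliable_qPoch (hq : X ∣ q) (y : PowerSeries ℤ) :
    Multipliable fun i : ℕ => 1 - y * q ^ i := by
  apply multipliable_of_X_pow_dvd
  intro n
  have : 1 - y * q ^ n - 1 = q ^ n * (-y) := by ring
  rw [this]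
  exact Dvd.dvd.mul_right (pow_dvd_pow_of_dvd hq n) _

theorem qPoch_step (hq : X ∣ q) (y : PowerSeries ℤ) :
    qPoch y q = (1 - y) * qPoch (y * q) q := by
  have h : (fun n : ℕ => 1 - y * q ^ (n + 1)) = fun n => 1 - y * q * q ^ n := by
    funext n; ring
  unfold qPoch
  rw [tprod_eq_zero_mul' (by rw [h]; exact multipliable_qPoch hq _), h]
  simp

theorem qPoch_even_mul_odd (hq : X ∣ q) (y : PowerSeries ℤ) :
    qPoch y (q ^ 2) * qPoch (y * q) (q ^ 2) = qPoch y q := by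
  have hq2 : X ∣ q ^ 2 := Dvd.dvd.pow hq two_ne_zero
  have h0 : (fun k : ℕ => 1 - y * q ^ (2 * k)) = fun k => 1 - y * (q ^ 2) ^ k := by
    funext k; ring
  have h1 : (fun k : ℕ => 1 - y * q ^ (2 * k + 1)) = fun k => 1 - y * q * (q ^ 2) ^ k := by
    funext k; ring
  have := tprod_even_mul_odd (f := fun k : ℕ => 1 - y * q ^ k)
    (by rw [h0]; exact multipliable_qPoch hq2 _) (by rw [h1]; exact multipliable_qPoch hq2 _)
  rw [h0, h1] at this
  exact this

theorem qPoch_mul_qPoch_neg (hq : X ∣ q) (y : PowerSeries ℤ) :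
    qPoch y q * qPoch (-y) q = qPoch (y ^ 2) (q ^ 2) := by
  unfold qPoch
  rw [← (multipliable_qPoch hq y).tprod_mul (multipliable_qPoch hq (-y))]
  congr 1
  funext i
  ring

theorem X_pow_dvd_qPoch_sub_one (hq : X ∣ q) {y : PowerSeries ℤ} {k : ℕ} (hy : X ^ k ∣ y) :
    X ^ k ∣ qPoch y q - 1 := by
  apply X_pow_dvd_tprod_sub_one (multipliable_qPoch hq y)
  intro n
  have : 1 - y * q ^ n - 1 = y * (-q ^ n) := by ring
  rw [this]
  exact Dvd.dvd.mul_right hy _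

theorem isUnit_qPoch (hq : X ∣ q) {y : PowerSeries ℤ} (hy : X ∣ y) : IsUnit (qPoch y q) :=
  isUnit_of_X_dvd_sub_one (by simpa using X_pow_dvd_qPoch_sub_one (k := 1) hq (by simpa using hy))

theorem qPoch_eq_prod_mul (hq : X ∣ q) (y : PowerSeries ℤ) (n : ℕ) :
    qPoch y q = (∏ i ∈ Finset.range n, (1 - y * q ^ i)) * qPoch (y * q ^ n) q := by
  induction n with
  | zero => simp
  | succ n ih =>
    rw [ih, Finset.prod_range_succ, qPoch_step hq (y * q ^ n), pow_succ]
    ring_nf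

end QPochhammer

/-! ### Telescoping recurrences for the finite $q$-sums. -/

section FiniteIdentities

theorem sum_Ico_int_telescope {R : Type*} [AddCommGroup R] (G : ℤ → R) (c : ℤ) (n : ℕ) :
    ∑ r ∈ Finset.Ico c (c + n), (G (r + 1) - G r) = G (c + n) - G c := by
  induction n with
  | zero => simp
  | succ n ih =>
    have : Finset.Ico c (c + (n + 1 : ℕ)) = insert (c + n) (Finset.Ico c (c + n)) := by
      ext; simp; omega
    rw [this, Finset.sum_insert (by simp), ih]
    push_cast
    rw [← add_assoc]
    abel

/-- A two-sided sequence behaving like `n ↦ 1 / (q²; q²)_n`, extended by zero to negative `n`. -/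
def IsInvPoch {R : Type*} [CommRing R] (q : R) (a : ℤ → R) : Prop :=
  ∀ n : ℤ, a n = (1 - q ^ (2 * (n + 1)).toNat) * a (n + 1)

variable {R : Type*} [CommRing R] {q : R} {a : ℤ → R}

theorem IsInvPoch.eq_zero (ha : IsInvPoch q a) {n : ℤ} (hn : n < 0) : a n = 0 := by
  -- Truncation makes the exponent $0$ for every negative $n$, so the factor $1-q^0$ vanishes.
  rw [ha n, Int.toNat_of_nonpos (by omega)]
  simp

/-- The sums `∑_r (-1)^r q^{e r²} a (n - r) a (n + r)`. -/
noncomputable def symmSum (q : R) (e : ℕ) (a : ℤ → R) (n : ℕ) : R :=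
  ∑ r ∈ Finset.Icc (-(n : ℤ)) n, (-1) ^ r.natAbs * q ^ (e * r.natAbs ^ 2) * (a (n - r) * a (n + r))

theorem symmSum_eq_of_le (ha : IsInvPoch q a) (e : ℕ) {n m : ℕ} (h : n ≤ m) :
    symmSum q e a n = ∑ r ∈ Finset.Icc (-(m : ℤ)) m,
      (-1) ^ r.natAbs * q ^ (e * r.natAbs ^ 2) * (a (n - r) * a (n + r)) := by
  apply Finset.sum_subset
  · intro x; simp; omega
  · intro x _ hx
    simp only [Finset.mem_Icc, not_and_or, not_le] at hx
    rcases hx with hx | hx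
    · rw [ha.eq_zero (show (n : ℤ) + x < 0 by omega)]; simp
    · rw [ha.eq_zero (show (n : ℤ) - x < 0 by omega)]; simp

theorem neg_one_pow_natAbs_succ (r : ℤ) :
    (-1 : R) ^ (r + 1).natAbs = -(-1) ^ r.natAbs := by
  rcases Int.even_or_odd r with h | h
  · rw [(Int.natAbs_even.2 h).neg_one_pow, (Int.natAbs_odd.2 h.add_one).neg_one_pow]
  · rw [(Int.natAbs_odd.2 h).neg_one_pow, (Int.natAbs_even.2 h.add_one).neg_one_pow, neg_neg]

theorem pow_natAbs_sq (q : R) (e : ℕ) (r : ℤ) :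
    q ^ (e * r.natAbs ^ 2) = q ^ (e * r ^ 2).toNat := by
  congr 1
  zify
  rw [Int.toNat_of_nonneg (by positivity)]
  simp

theorem pow_toNat_add (q : R) {m n : ℤ} (hm : 0 ≤ m) (hn : 0 ≤ n) :
    q ^ (m + n).toNat = q ^ m.toNat * q ^ n.toNat := by
  rw [Int.toNat_add hm hn, pow_add]

/-- Telescoping over a symmetric integer interval in which both end terms vanish. -/
theorem sum_Icc_symm_eq_zero {R : Type*} [AddCommGroup R] (F G : ℤ → R) (n : ℕ)
    (h : ∀ r : ℤ, -(n : ℤ) ≤ r → r ≤ n → F r = G (r + 1) - G r)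
    (h0 : G (-(n : ℤ)) = 0) (h1 : G (n + 1) = 0) :
    ∑ r ∈ Finset.Icc (-(n : ℤ)) n, F r = 0 := by
  have h2 : Finset.Icc (-(n : ℤ)) n = Finset.Ico (-(n : ℤ)) (-(n : ℤ) + (2 * n + 1 : ℕ)) := by
    ext; simp; omega
  rw [Finset.sum_congr rfl fun r hr => h r (Finset.mem_Icc.1 hr).1 (Finset.mem_Icc.1 hr).2, h2,
    sum_Ico_int_telescope, h0]
  have : -(n : ℤ) + (2 * n + 1 : ℕ) = n + 1 := by push_cast; ring
  rw [this, h1, sub_zero]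

/-- The recurrence of $1/(q^4;q^4)_n$, obtained by creative telescoping: the supplied function of
$r$ is a certificate whose differences are the summands, and which vanishes at both ends because `a`
does at $-1$. -/
theorem symmSum_two_step (ha : IsInvPoch q a) (n : ℕ) :
    symmSum q 2 a n = (1 - q ^ (4 * n + 4)) * symmSum q 2 a (n + 1) := by
  rw [eq_comm, ← sub_eq_zero, symmSum_eq_of_le ha 2 (Nat.le_succ n), symmSum, Finset.mul_sum,
    ← Finset.sum_sub_distrib]
  apply sum_Icc_symm_eq_zero _ (fun r : ℤ => -((-1) ^ r.natAbs * q ^ (2 * r.natAbs ^ 2) *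
    q ^ (2 * (n + 1 - r)).toNat * (a (n + 1 - r) * a (n + r))))
  · intro r hr1 hr2
    push_cast at hr1 hr2
    rw [neg_one_pow_natAbs_succ, pow_natAbs_sq, pow_natAbs_sq]
    have hA := ha (n - r)
    have hB := ha (n + r)
    rw [show (n : ℤ) - r + 1 = n + 1 - r by ring] at hA
    rw [show (n : ℤ) + r + 1 = n + 1 + r by ring] at hB
    have e1 : (n : ℤ) + 1 - (r + 1) = n - r := by ring
    have e2 : (n : ℤ) + (r + 1) = n + 1 + r := by ring
    have hC : q ^ (4 * n + 4) = q ^ (2 * ((n : ℤ) + 1 - r)).toNat *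
        q ^ (2 * ((n : ℤ) + 1 + r)).toNat := by
      rw [← pow_toNat_add q (by omega) (by omega)]
      congr 1; omega
    rw [e1, e2, hB]
    push_cast
    rw [hC]
    -- At $r=n+1$ the exponent $2(n-r)$ is negative and truncated, so `hD` is unavailable; there `a
    -- (n - r) = 0` settles the identity.
    rcases eq_or_lt_of_le hr2 with h | h
    · rw [ha.eq_zero (show (n : ℤ) - r < 0 by omega), ← h]
      simp
      ring
    · have hD : q ^ (2 * (r + 1) ^ 2).toNat * q ^ (2 * ((n : ℤ) - r)).toNat =
          q ^ (2 * r ^ 2).toNat * q ^ (2 * ((n : ℤ) + 1 + r)).toNat := by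
        rw [← pow_toNat_add q (by positivity) (by omega),
          ← pow_toNat_add q (by positivity) (by omega)]
        congr 2; ring
      rw [hA]
      linear_combination ((-1) ^ r.natAbs * (1 - q ^ (2 * ((n : ℤ) + 1 - r)).toNat) *
        a (n + 1 - r) * a (n + 1 + r)) * (-hD)
  · rw [ha.eq_zero (n := (n : ℤ) + _) (by push_cast; omega)]; simp
  · rw [ha.eq_zero (n := (n : ℤ) + 1 - _) (by push_cast; omega)]; simp

/-- Creative telescoping again; the certificate now has two terms, matched by the exponent
identities `hD` and `hE`. -/
theorem symmSum_one_step (ha : IsInvPoch q a) (n : ℕ) :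
    (1 - q ^ (2 * n + 1)) * symmSum q 1 a n =
      (1 + q ^ (2 * n + 1)) * (1 - q ^ (4 * n + 4)) * symmSum q 1 a (n + 1) := by
  rw [eq_comm, ← sub_eq_zero, symmSum_eq_of_le ha 1 (Nat.le_succ n), symmSum, Finset.mul_sum,
    Finset.mul_sum, ← Finset.sum_sub_distrib]
  apply sum_Icc_symm_eq_zero _ (fun r : ℤ => -((-1) ^ r.natAbs * q ^ (1 * r.natAbs ^ 2) *
    (q ^ (2 * n + 1) + q ^ (2 * (n + 1 - r)).toNat) * (a (n + 1 - r) * a (n + r))))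
  · intro r hr1 hr2
    push_cast at hr1 hr2
    rw [neg_one_pow_natAbs_succ, pow_natAbs_sq, pow_natAbs_sq]
    have hA := ha (n - r)
    have hB := ha (n + r)
    rw [show (n : ℤ) - r + 1 = n + 1 - r by ring] at hA
    rw [show (n : ℤ) + r + 1 = n + 1 + r by ring] at hB
    have e1 : (n : ℤ) + 1 - (r + 1) = n - r := by ring
    have e2 : (n : ℤ) + (r + 1) = n + 1 + r := by ring
    have hC : q ^ (4 * n + 4) = q ^ (2 * ((n : ℤ) + 1 - r)).toNat *
        q ^ (2 * ((n : ℤ) + 1 + r)).toNat := by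
      rw [← pow_toNat_add q (by omega) (by omega)]
      congr 1; omega
    rw [e1, e2, hB]
    push_cast
    rw [hC]
    simp only [one_mul]
    rcases eq_or_lt_of_le hr2 with h | h
    · rw [ha.eq_zero (show (n : ℤ) - r < 0 by omega), ← h]
      simp only [sub_self, mul_zero, Int.toNat_zero, pow_zero, zero_mul, neg_zero, zero_sub]
      ring
    · have hx : q ^ (2 * n + 1) = q ^ (2 * (n : ℤ) + 1).toNat := by congr 1
      have hD : q ^ ((r + 1) ^ 2).toNat * q ^ (2 * ((n : ℤ) - r)).toNat =
          q ^ (r ^ 2).toNat * q ^ (2 * n + 1) := by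
        rw [hx, ← pow_toNat_add q (by positivity) (by omega),
          ← pow_toNat_add q (by positivity) (by omega)]
        congr 2; ring
      have hE : q ^ ((r + 1) ^ 2).toNat * q ^ (2 * n + 1) =
          q ^ (r ^ 2).toNat * q ^ (2 * ((n : ℤ) + 1 + r)).toNat := by
        rw [hx, ← pow_toNat_add q (by positivity) (by omega),
          ← pow_toNat_add q (by positivity) (by omega)]
        congr 2; ring
      rw [hA]
      linear_combination ((-1) ^ r.natAbs * (1 - q ^ (2 * ((n : ℤ) + 1 - r)).toNat) *
        a (n + 1 - r) * a (n + 1 + r)) * (-hD - hE)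
  · rw [ha.eq_zero (n := (n : ℤ) + _) (by push_cast; omega)]; simp
  · rw [ha.eq_zero (n := (n : ℤ) + 1 - _) (by push_cast; omega)]; simp

/-- The finite product `(-q; q²)_n`. -/
def oddPlusProd (q : R) (n : ℕ) : R := ∏ i ∈ Finset.range n, (1 + q ^ (2 * i + 1))

/-- The left side of the `q`-Chu–Vandermonde sum. -/
def chuSum (q : R) (a : ℤ → R) (r : ℤ) (n : ℕ) : R :=
  ∑ j ∈ Finset.range (n + 1),
    oddPlusProd q j * q ^ (j ^ 2) * (a (n - j) * a (j - r) * a (j + r))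

/-- Telescoping in $j$ with $r$ fixed. This is the ratio of consecutive values of the closed form in
`chuSum_eq`, cleared of denominators. -/
theorem chuSum_step (ha : IsInvPoch q a) {r : ℤ} {n : ℕ} (hr : r.natAbs ≤ n) :
    (1 + q ^ (2 * n + 1)) * chuSum q a r n =
      (1 - q ^ (2 * ((n : ℤ) + 1 - r)).toNat) * (1 - q ^ (2 * ((n : ℤ) + 1 + r)).toNat) *
        chuSum q a r (n + 1) := by
  have hext : chuSum q a r n = ∑ j ∈ Finset.range (n + 1 + 1),
      oddPlusProd q j * q ^ (j ^ 2) * (a (n - j) * a (j - r) * a (j + r)) := by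
    rw [Finset.sum_range_succ, ha.eq_zero (n := (n : ℤ) - _) (by push_cast; omega)]
    simp [chuSum]
  rw [eq_comm, ← sub_eq_zero, hext, chuSum, Finset.mul_sum, Finset.mul_sum,
    ← Finset.sum_sub_distrib]
  -- The telescoping certificate, kept opaque so that rewriting does not unfold it.
  obtain ⟨G, hG⟩ : ∃ G : ℕ → R, ∀ j : ℕ, G j = -(oddPlusProd q j * q ^ (j ^ 2) *
      q ^ (2 * ((n : ℤ) + 1 - j)).toNat * (a (n + 1 - j) * a (j - 1 - r) * a (j - 1 + r))) :=
    ⟨_, fun _ => rfl⟩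
  have key : ∀ j ∈ Finset.range (n + 1 + 1),
      (1 - q ^ (2 * ((n : ℤ) + 1 - r)).toNat) * (1 - q ^ (2 * ((n : ℤ) + 1 + r)).toNat) *
        (oddPlusProd q j * q ^ (j ^ 2) * (a ((n + 1 : ℕ) - j) * a (j - r) * a (j + r))) -
      (1 + q ^ (2 * n + 1)) * (oddPlusProd q j * q ^ (j ^ 2) *
        (a (n - j) * a (j - r) * a (j + r))) =
      G (j + 1) - G j := by
    intro j hj
    rw [Finset.mem_range] at hj
    rw [hG, hG]
    have hU := ha (n - j)
    have hV := ha (j - 1 - r)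
    have hW := ha (j - 1 + r)
    rw [show (n : ℤ) - j + 1 = n + 1 - j by ring] at hU
    rw [show (j : ℤ) - 1 - r + 1 = j - r by ring] at hV
    rw [show (j : ℤ) - 1 + r + 1 = j + r by ring] at hW
    have hP : oddPlusProd q (j + 1) = oddPlusProd q j * (1 + q ^ (2 * j + 1)) :=
      Finset.prod_range_succ _ _
    have e1 : (n : ℤ) + 1 - (j + 1) = n - j := by ring
    have e2 : (j : ℤ) + 1 - 1 - r = j - r := by ring
    have e3 : (j : ℤ) + 1 - 1 + r = j + r := by ring
    push_cast
    rw [hP, e1, e2, e3]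
    -- Below $|r|$ some exponents would be truncated, but every term contains an `a` at a negative
    -- index.
    rcases lt_or_ge j r.natAbs with h | h
    · have h0 : a (j - r) * a (j + r) = 0 := by
        rcases le_total 0 r with h3 | h3
        · rw [ha.eq_zero (show (j : ℤ) - r < 0 by omega)]; simp
        · rw [ha.eq_zero (show (j : ℤ) + r < 0 by omega)]; simp
      have h1 : a (j - 1 - r) * a (j - 1 + r) = 0 := by
        rcases le_total 0 r with h3 | h3
        · rw [ha.eq_zero (show (j : ℤ) - 1 - r < 0 by omega)]; simp
        · rw [ha.eq_zero (show (j : ℤ) - 1 + r < 0 by omega)]; simp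
      simp only [mul_assoc _ (a (j - r)), mul_assoc _ (a (j - 1 - r)), h0, h1]
      simp
    · rw [hV, hW]
      have hZ1 : q ^ (2 * ((n : ℤ) + 1 - r)).toNat = q ^ (2 * ((n : ℤ) + 1 - j)).toNat *
          q ^ (2 * ((j : ℤ) - r)).toNat := by
        rw [← pow_toNat_add q (by omega) (by omega)]
        congr 1; omega
      have hZ2 : q ^ (2 * ((n : ℤ) + 1 + r)).toNat = q ^ (2 * ((n : ℤ) + 1 - j)).toNat *
          q ^ (2 * ((j : ℤ) + r)).toNat := by
        rw [← pow_toNat_add q (by omega) (by omega)]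
        congr 1; omega
      have hxt : q ^ (2 * n + 1) * q ^ (2 * j + 1) = q ^ (2 * ((n : ℤ) + 1 - j)).toNat *
          q ^ (2 * ((j : ℤ) - r)).toNat * q ^ (2 * ((j : ℤ) + r)).toNat := by
        rw [← pow_toNat_add q (by omega) (by omega), ← pow_toNat_add q (by omega) (by omega),
          ← pow_add]
        congr 1; omega
      rw [hZ1, hZ2]
      rcases eq_or_lt_of_le (Nat.lt_succ_iff.1 hj) with h4 | h4
      · rw [ha.eq_zero (show (n : ℤ) - j < 0 by omega)]
        have h5 : (2 * ((n : ℤ) + 1 - j)).toNat = 0 := by omega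
        simp only [h5]
        ring
      · have hD : q ^ ((j + 1) ^ 2) * q ^ (2 * ((n : ℤ) - j)).toNat =
            q ^ (j ^ 2) * q ^ (2 * n + 1) := by
          rw [← pow_add, ← pow_add]
          congr 1
          have : (2 * ((n : ℤ) - j)).toNat = 2 * (n - j) := by omega
          rw [this]
          obtain ⟨k, rfl⟩ := Nat.exists_eq_add_of_le (show j ≤ n by omega)
          rw [Nat.add_sub_cancel_left]
          ring
        rw [hU]
        linear_combination ((oddPlusProd q j * (1 - q ^ (2 * ((n : ℤ) + 1 - j)).toNat) *
          a (n + 1 - j) * a (j - r) * a (j + r) * (1 + q ^ (2 * j + 1)))) * hD +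
          ((oddPlusProd q j * (1 - q ^ (2 * ((n : ℤ) + 1 - j)).toNat) *
          a (n + 1 - j) * a (j - r) * a (j + r) * q ^ (j ^ 2))) * hxt
  rw [Finset.sum_congr rfl key, Finset.sum_range_sub, hG, hG]
  have h0 : a ((0 : ℕ) - 1 - r) * a ((0 : ℕ) - 1 + r) = 0 := by
    rcases le_total 0 r with h3 | h3
    · rw [ha.eq_zero (show ((0 : ℕ) : ℤ) - 1 - r < 0 by omega)]; simp
    · rw [ha.eq_zero (show ((0 : ℕ) : ℤ) - 1 + r < 0 by omega)]; simp
  simp only [mul_assoc _ (a ((0 : ℕ) - 1 - r)), h0]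
  rw [ha.eq_zero (show (n : ℤ) + 1 - ((n + 1 + 1 : ℕ) : ℤ) < 0 by push_cast; omega)]
  simp

end FiniteIdentities

/-! ### Closed forms by induction, and the finite Bailey transform. -/

section FiniteClosedForms

variable {R : Type*} [CommRing R] {q : R} {a : ℤ → R}

/-- Starting values for the induction on $n$: terms with $j<|r|$ vanish, so only $j=n$ can
contribute, and only when $n=|r|$. -/
theorem chuSum_of_le_natAbs (ha : IsInvPoch q a) (h0 : a 0 = 1) {r : ℤ} {n : ℕ}
    (hr : n ≤ r.natAbs) :
    chuSum q a r n = oddPlusProd q n * q ^ (r.natAbs ^ 2) * (a (n - r) * a (n + r)) := by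
  have hz : ∀ j : ℕ, j < r.natAbs → a (j - r) * a (j + r) = 0 := by
    intro j h
    rcases le_total 0 r with h3 | h3
    · rw [ha.eq_zero (show (j : ℤ) - r < 0 by omega)]; simp
    · rw [ha.eq_zero (show (j : ℤ) + r < 0 by omega)]; simp
  rw [chuSum, Finset.sum_range_succ, Finset.sum_eq_zero, sub_self, h0]
  · rcases eq_or_lt_of_le hr with h | h
    · rw [← h]; ring
    · simp only [one_mul, hz n h]; ring
  · intro j hj
    simp only [mul_assoc (a _) (a _) (a _), hz j (by simp at hj; omega)]
    simp

/-- A finite form of the `q`-Chu–Vandermonde sum. -/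
theorem chuSum_eq (ha : IsInvPoch q a) (h0 : a 0 = 1) (hu : ∀ k, 0 < k → IsUnit (1 - q ^ k))
    (r : ℤ) (n : ℕ) :
    chuSum q a r n = oddPlusProd q n * q ^ (r.natAbs ^ 2) * (a (n - r) * a (n + r)) := by
  induction n with
  | zero => exact chuSum_of_le_natAbs ha h0 (Nat.zero_le _)
  | succ n ih =>
    rcases Nat.lt_or_ge n r.natAbs with h | h
    · exact chuSum_of_le_natAbs ha h0 h
    · have h1 := chuSum_step ha h
      have hu1 := hu (2 * ((n : ℤ) + 1 - r)).toNat (by omega)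
      have hu2 := hu (2 * ((n : ℤ) + 1 + r)).toNat (by omega)
      apply (hu1.mul hu2).mul_left_cancel
      have hA := ha (n - r)
      have hB := ha (n + r)
      rw [show (n : ℤ) - r + 1 = n + 1 - r by ring] at hA
      rw [show (n : ℤ) + r + 1 = n + 1 + r by ring] at hB
      have hP : oddPlusProd q (n + 1) = oddPlusProd q n * (1 + q ^ (2 * n + 1)) :=
        Finset.prod_range_succ _ _
      rw [← h1, ih, hA, hB, hP]
      push_cast
      ring

/-- The Bailey transform of the pair generated by `symmSum q 2 a`. -/
theorem sum_symmSum_two_eq (ha : IsInvPoch q a) (h0 : a 0 = 1)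
    (hu : ∀ k, 0 < k → IsUnit (1 - q ^ k)) (N : ℕ) :
    ∑ j ∈ Finset.range (N + 1), oddPlusProd q j * q ^ (j ^ 2) * a (N - j) * symmSum q 2 a j =
      oddPlusProd q N * symmSum q 3 a N := by
  have h1 : ∀ j ∈ Finset.range (N + 1),
      oddPlusProd q j * q ^ (j ^ 2) * a (N - j) * symmSum q 2 a j =
      ∑ r ∈ Finset.Icc (-(N : ℤ)) N, (-1) ^ r.natAbs * q ^ (2 * r.natAbs ^ 2) *
        (oddPlusProd q j * q ^ (j ^ 2) * (a (N - j) * a (j - r) * a (j + r))) := by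
    intro j hj
    rw [symmSum_eq_of_le ha 2 (show j ≤ N by simp at hj; omega), Finset.mul_sum]
    exact Finset.sum_congr rfl fun r _ => by ring
  rw [Finset.sum_congr rfl h1, Finset.sum_comm, symmSum, Finset.mul_sum]
  refine Finset.sum_congr rfl fun r _ => ?_
  rw [← Finset.mul_sum]
  have h2 := chuSum_eq ha h0 hu r N
  rw [chuSum] at h2
  rw [h2]
  ring

/-- Gauss's finite form of the theta product. -/
theorem symmSum_one_eq (ha : IsInvPoch q a) (h0 : a 0 = 1) (hu : ∀ k, 0 < k → IsUnit (1 - q ^ k))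
    (n : ℕ) :
    symmSum q 1 a n = (∏ i ∈ Finset.range n, (1 - q ^ (2 * i + 1))) ^ 2 * a (2 * n) := by
  induction n with
  | zero => simp [symmSum, h0]
  | succ n ih =>
    have h1 := symmSum_one_step ha n
    have hu1 : IsUnit (1 + q ^ (2 * n + 1)) := by
      -- $1+q^{2n+1}$ divides the unit $1-q^{4n+2}$.
      apply isUnit_of_mul_isUnit_right (x := 1 - q ^ (2 * n + 1))
      convert hu (4 * n + 2) (by omega) using 1
      ring
    have hu2 := hu (4 * n + 4) (by omega)
    apply (hu1.mul hu2).mul_left_cancel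
    have hA := ha (2 * n)
    have hB := ha (2 * n + 1)
    have e1 : (2 * (2 * (n : ℤ) + 1)).toNat = 4 * n + 2 := by omega
    have e2 : (2 * (2 * (n : ℤ) + 1 + 1)).toNat = 4 * n + 4 := by omega
    rw [e1] at hA
    rw [e2] at hB
    rw [← h1, ih, hA, hB, Finset.prod_range_succ]
    push_cast
    rw [show 2 * ((n : ℤ) + 1) = 2 * n + 1 + 1 by ring]
    ring

end FiniteClosedForms

/-! ### Limits of the finite identities, as congruences modulo $X^N$. -/

section PowerSeriesLimits

variable {q : PowerSeries ℤ}

/-- The power series `1 / (q²; q²)_n`, extended by zero to negative `n`. -/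
noncomputable def invPoch (q : PowerSeries ℤ) (n : ℤ) : PowerSeries ℤ :=
  if n < 0 then 0
  else Ring.inverse (qPoch (q ^ 2) (q ^ 2)) * qPoch (q ^ (2 * (n + 1)).toNat) (q ^ 2)

/-- Since $1/(q^2;q^2)_n$ is represented as $(q^{2n+2};q^2)_\infty/(q^2;q^2)_\infty$, the recurrence
is one application of `qPoch_step`, with $1-q^0=0$ at $n=-1$. -/
theorem isInvPoch_invPoch (hq : X ∣ q) : IsInvPoch q (invPoch q) := by
  intro n
  have hq2 : X ∣ q ^ 2 := Dvd.dvd.pow hq two_ne_zero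
  unfold invPoch
  rcases lt_trichotomy n (-1) with h | rfl | h
  · simp [show n < 0 by omega, show n + 1 < 0 by omega]
  · simp
  · rw [if_neg (by omega), if_neg (by omega),
      qPoch_step hq2 (q ^ (2 * (n + 1)).toNat),
      show (2 * (n + 1 + 1)).toNat = (2 * (n + 1)).toNat + 2 by omega, pow_add]
    ring

theorem invPoch_zero (hq : X ∣ q) : invPoch q 0 = 1 := by
  have hq2 : X ∣ q ^ 2 := Dvd.dvd.pow hq two_ne_zero
  simp [invPoch, Ring.inverse_mul_cancel _ (isUnit_qPoch hq2 hq2)]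

theorem isUnit_one_sub_pow (hq : X ∣ q) {k : ℕ} (hk : 0 < k) : IsUnit (1 - q ^ k) := by
  apply isUnit_of_X_dvd_sub_one
  simpa using Dvd.dvd.pow hq hk.ne'

theorem X_pow_dvd_invPoch_sub (hq : X ∣ q) (n : ℕ) :
    X ^ (2 * (n + 1)) ∣ invPoch q n - Ring.inverse (qPoch (q ^ 2) (q ^ 2)) := by
  have hq2 : X ∣ q ^ 2 := Dvd.dvd.pow hq two_ne_zero
  rw [invPoch, if_neg (by omega), show (2 * ((n : ℤ) + 1)).toNat = 2 * (n + 1) by omega,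
    ← mul_sub_one]
  exact Dvd.dvd.mul_left (X_pow_dvd_qPoch_sub_one hq2 (pow_dvd_pow_of_dvd hq _)) _

/-- The partial theta sum `∑_{|r| ≤ N} (-1)^r q^{e r²}`. -/
noncomputable def thetaSum (q : PowerSeries ℤ) (e N : ℕ) : PowerSeries ℤ :=
  ∑ r ∈ Finset.Icc (-(N : ℤ)) N, (-1) ^ r.natAbs * q ^ (e * r.natAbs ^ 2)

/-- In the term of index $r$, the power of $q$ supplies $X^{|r|}$, while replacing both factors
`invPoch` by their limit costs a multiple of $X^{N-|r|}$. -/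
theorem X_pow_dvd_symmSum_sub (hq : X ∣ q) {e : ℕ} (he : 0 < e) (N : ℕ) :
    X ^ N ∣ symmSum q e (invPoch q) N -
      Ring.inverse (qPoch (q ^ 2) (q ^ 2)) ^ 2 * thetaSum q e N := by
  rw [symmSum, thetaSum, Finset.mul_sum, ← Finset.sum_sub_distrib]
  apply Finset.dvd_sum
  intro r hr
  rw [Finset.mem_Icc] at hr
  set c := Ring.inverse (qPoch (q ^ 2) (q ^ 2))
  obtain ⟨k, hk⟩ := Int.eq_ofNat_of_zero_le (show 0 ≤ (N : ℤ) - r by omega)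
  obtain ⟨l, hl⟩ := Int.eq_ofNat_of_zero_le (show 0 ≤ (N : ℤ) + r by omega)
  rw [hk, hl]
  have e1 : (-1) ^ r.natAbs * q ^ (e * r.natAbs ^ 2) * (invPoch q k * invPoch q l) -
      c ^ 2 * ((-1) ^ r.natAbs * q ^ (e * r.natAbs ^ 2)) =
      q ^ (e * r.natAbs ^ 2) * ((invPoch q k - c) * invPoch q l + c * (invPoch q l - c)) *
        (-1) ^ r.natAbs := by ring
  rw [e1]
  apply Dvd.dvd.mul_right
  have hm : ∀ m : ℕ, N - r.natAbs ≤ m → X ^ (N - r.natAbs) ∣ invPoch q m - c := fun m hm =>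
    (pow_dvd_pow X (by omega)).trans (X_pow_dvd_invPoch_sub hq m)
  have h1 : X ^ r.natAbs ∣ q ^ (e * r.natAbs ^ 2) :=
    (pow_dvd_pow X ((Nat.le_self_pow two_ne_zero _).trans (Nat.le_mul_of_pos_left _ he))).trans (pow_dvd_pow_of_dvd hq _)
  have h2 : X ^ (N - r.natAbs) ∣ (invPoch q k - c) * invPoch q l + c * (invPoch q l - c) :=
    dvd_add (Dvd.dvd.mul_right (hm k (by omega)) _) (Dvd.dvd.mul_left (hm l (by omega)) _)
  refine (pow_dvd_pow X (show N ≤ r.natAbs + (N - r.natAbs) by omega)).trans ?_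
  rw [pow_add]
  exact mul_dvd_mul h1 h2

/-- Gauss's theta identity `∑ (-1)^r q^{r²} = (q; q²)_∞² (q²; q²)_∞`, modulo powers of `X`. -/
theorem X_pow_dvd_thetaSum_one_sub (hq : X ∣ q) (N : ℕ) :
    X ^ N ∣ thetaSum q 1 N - qPoch q (q ^ 2) ^ 2 * qPoch (q ^ 2) (q ^ 2) := by
  have hq2 : X ∣ q ^ 2 := Dvd.dvd.pow hq two_ne_zero
  have hu := isUnit_qPoch hq2 hq2
  set b := qPoch (q ^ 2) (q ^ 2) with hb
  set c := Ring.inverse b with hc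
  have hbc : b * c = 1 := Ring.mul_inverse_cancel _ hu
  set O := qPoch q (q ^ 2) with hO
  set P := ∏ i ∈ Finset.range N, (1 - q ^ (2 * i + 1)) with hP
  have h1 : X ^ N ∣ symmSum q 1 (invPoch q) N - c ^ 2 * thetaSum q 1 N :=
    X_pow_dvd_symmSum_sub hq one_pos N
  rw [symmSum_one_eq (isInvPoch_invPoch hq) (invPoch_zero hq)
    (fun k hk => isUnit_one_sub_pow hq hk), ← hP] at h1
  have h2 : X ^ N ∣ invPoch q (2 * N) - c := by
    have := X_pow_dvd_invPoch_sub hq (2 * N)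
    push_cast at this
    exact (pow_dvd_pow X (by omega)).trans this
  have h3 : X ^ N ∣ O - P := by
    have h4 : O = P * qPoch (q * (q ^ 2) ^ N) (q ^ 2) := by
      rw [hO, qPoch_eq_prod_mul hq2 q N, hP]
      congr 1
      exact Finset.prod_congr rfl fun i _ => by ring
    rw [h4, ← mul_sub_one]
    refine Dvd.dvd.mul_left (X_pow_dvd_qPoch_sub_one hq2 ?_) _
    exact Dvd.dvd.mul_left (pow_dvd_pow_of_dvd hq2 _) _
  have e1 : thetaSum q 1 N - O ^ 2 * b =
      -((P ^ 2 * invPoch q (2 * N) - c ^ 2 * thetaSum q 1 N) * b ^ 2) +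
      (invPoch q (2 * N) - c) * (P ^ 2 * b ^ 2) - (O - P) * ((O + P) * c * b ^ 2) := by
    have h5 : c ^ 2 * b ^ 2 = 1 := by rw [← mul_pow, mul_comm, hbc, one_pow]
    have h6 : c * b ^ 2 = b := by linear_combination b * hbc
    linear_combination (-thetaSum q 1 N) * h5 + O ^ 2 * h6
  rw [e1]
  exact dvd_sub (dvd_add ((Dvd.dvd.mul_right h1 _).neg_right) (Dvd.dvd.mul_right h2 _))
    (Dvd.dvd.mul_right h3 _)

theorem X_pow_dvd_oddPlusProd_sub (hq : X ∣ q) (N : ℕ) :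
    X ^ N ∣ oddPlusProd q N - qPoch (-q) (q ^ 2) := by
  have hq2 : X ∣ q ^ 2 := Dvd.dvd.pow hq two_ne_zero
  have h4 : qPoch (-q) (q ^ 2) = oddPlusProd q N * qPoch (-q * (q ^ 2) ^ N) (q ^ 2) := by
    rw [qPoch_eq_prod_mul hq2 (-q) N, oddPlusProd]
    congr 1
    exact Finset.prod_congr rfl fun i _ => by ring
  rw [h4, dvd_sub_comm, ← mul_sub_one]
  refine Dvd.dvd.mul_left (X_pow_dvd_qPoch_sub_one hq2 ?_) _
  exact Dvd.dvd.mul_left (pow_dvd_pow_of_dvd hq2 _) _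

/-- The limit of the Bailey transform, modulo powers of `X`. -/
theorem X_pow_dvd_sum_symmSum_two_sub (hq : X ∣ q) (N : ℕ) :
    X ^ N ∣ qPoch (q ^ 2) (q ^ 2) *
        ∑ j ∈ Finset.range (N + 1), oddPlusProd q j * q ^ (j ^ 2) * symmSum q 2 (invPoch q) j -
      qPoch (-q) (q ^ 2) * thetaSum q 3 N := by
  have hq2 : X ∣ q ^ 2 := Dvd.dvd.pow hq two_ne_zero
  have hu := isUnit_qPoch hq2 hq2
  set b := qPoch (q ^ 2) (q ^ 2) with hb
  set c := Ring.inverse b with hc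
  have hbc : b * c = 1 := Ring.mul_inverse_cancel _ hu
  have h1 := sum_symmSum_two_eq (isInvPoch_invPoch hq) (invPoch_zero hq)
    (fun k hk => isUnit_one_sub_pow hq hk) N
  have h2 : X ^ N ∣ symmSum q 3 (invPoch q) N - c ^ 2 * thetaSum q 3 N :=
    X_pow_dvd_symmSum_sub hq (by norm_num) N
  have h3 := X_pow_dvd_oddPlusProd_sub hq N
  have h4 : X ^ N ∣ ∑ j ∈ Finset.range (N + 1), oddPlusProd q j * q ^ (j ^ 2) *
      invPoch q (N - j) * symmSum q 2 (invPoch q) j -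
      c * ∑ j ∈ Finset.range (N + 1), oddPlusProd q j * q ^ (j ^ 2) *
        symmSum q 2 (invPoch q) j := by
    rw [Finset.mul_sum, ← Finset.sum_sub_distrib]
    refine Finset.dvd_sum fun j hj => ?_
    rw [Finset.mem_range] at hj
    have e1 : oddPlusProd q j * q ^ (j ^ 2) * invPoch q (N - j) * symmSum q 2 (invPoch q) j -
        c * (oddPlusProd q j * q ^ (j ^ 2) * symmSum q 2 (invPoch q) j) =
        q ^ (j ^ 2) * (invPoch q (N - j) - c) *
          (oddPlusProd q j * symmSum q 2 (invPoch q) j) := by ring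
    rw [e1]
    apply Dvd.dvd.mul_right
    have h5 := X_pow_dvd_invPoch_sub hq (N - j)
    rw [Nat.cast_sub (by omega)] at h5
    -- $X^j$ comes from $q^{j^2}$ and $X^{N-j}$ from the convergence of `invPoch`.
    refine (pow_dvd_pow X (show N ≤ j + (N - j) by omega)).trans ?_
    rw [pow_add]
    exact mul_dvd_mul ((pow_dvd_pow X (by nlinarith)).trans (pow_dvd_pow_of_dvd hq _))
      ((pow_dvd_pow X (by omega)).trans h5)
  rw [h1] at h4
  generalize ∑ j ∈ Finset.range (N + 1), oddPlusProd q j * q ^ (j ^ 2) *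
    symmSum q 2 (invPoch q) j = S at *
  set d := qPoch (-q) (q ^ 2)
  have h6 : c * b ^ 2 = b := by linear_combination b * hbc
  have h5 : c ^ 2 * b ^ 2 = 1 := by rw [← mul_pow, mul_comm, hbc, one_pow]
  have e1 : b * S - d * thetaSum q 3 N =
      -((oddPlusProd q N * symmSum q 3 (invPoch q) N - c * S) * b ^ 2) +
      (symmSum q 3 (invPoch q) N - c ^ 2 * thetaSum q 3 N) * (oddPlusProd q N * b ^ 2) +
      (oddPlusProd q N - d) * thetaSum q 3 N := by
    linear_combination (-S) * h6 + thetaSum q 3 N * oddPlusProd q N * h5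
  rw [e1]
  exact dvd_add (dvd_add ((Dvd.dvd.mul_right h4 _).neg_right) (Dvd.dvd.mul_right h2 _))
    (Dvd.dvd.mul_right h3 _)

end PowerSeriesLimits

/-! ### The series $C_{i,j}$: contiguous relations and product formula. -/

section ChainSeries

/-- The product `(-X^{2j}; X²)_∞`. -/
noncomputable def evenPlusTail (j : ℕ) : PowerSeries ℤ := qPoch (-X ^ (2 * j)) (X ^ 2)

theorem X_dvd_X_sq : (X : PowerSeries ℤ) ∣ X ^ 2 := dvd_pow_self X two_ne_zero

theorem evenPlusTail_step (j : ℕ) :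
    evenPlusTail j = (1 + X ^ (2 * j)) * evenPlusTail (j + 1) := by
  unfold evenPlusTail
  rw [qPoch_step X_dvd_X_sq, sub_neg_eq_add, neg_mul, ← pow_add]
  rfl

/-- The power series `(-X; X²)_k / (X²; X²)_k`. -/
noncomputable def chainCoeff (k : ℕ) : PowerSeries ℤ := oddPlusProd X k * invPoch X k

theorem chainCoeff_step (k : ℕ) :
    (1 - X ^ (2 * k + 2)) * chainCoeff (k + 1) = (1 + X ^ (2 * k + 1)) * chainCoeff k := by
  have hA := isInvPoch_invPoch (q := X) dvd_rfl k
  rw [show (2 * ((k : ℤ) + 1)).toNat = 2 * k + 2 by omega] at hA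
  have hP : oddPlusProd (X : PowerSeries ℤ) (k + 1) = oddPlusProd X k * (1 + X ^ (2 * k + 1)) :=
    Finset.prod_range_succ _ _
  rw [chainCoeff, chainCoeff, hP, hA]
  push_cast
  ring

theorem chainCoeff_zero : chainCoeff 0 = 1 := by
  simp [chainCoeff, oddPlusProd, invPoch_zero (q := X) dvd_rfl]

/-- The series `∑_k X^{k² + 2ik} (-X; X²)_k / (X²; X²)_k (-X^{2(k + j)}; X²)_∞`. -/
noncomputable def chainSeries (i j : ℕ) : PowerSeries ℤ :=
  ∑' k : ℕ, X ^ (k ^ 2 + 2 * i * k) * (chainCoeff k * evenPlusTail (k + j))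

theorem X_pow_dvd_X_pow_sq (k m : ℕ) : (X : PowerSeries ℤ) ^ k ∣ X ^ (k ^ 2 + m) :=
  pow_dvd_pow X ((Nat.le_self_pow two_ne_zero k).trans (Nat.le_add_right _ _))

theorem summable_chainSeries (i j : ℕ) : Summable fun k : ℕ =>
    (X : PowerSeries ℤ) ^ (k ^ 2 + 2 * i * k) * (chainCoeff k * evenPlusTail (k + j)) :=
  summable_of_X_pow_dvd fun k => Dvd.dvd.mul_right (X_pow_dvd_X_pow_sq k _) _

/-- Termwise: peel the first factor off the tail $(-X^{2(k+i)};X^2)_\infty$. -/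
theorem chainSeries_self (i : ℕ) :
    chainSeries i i = chainSeries i (i + 1) + X ^ (2 * i) * chainSeries (i + 1) (i + 1) := by
  unfold chainSeries
  rw [← (summable_chainSeries (i + 1) (i + 1)).tsum_mul_left,
    ← (summable_chainSeries i (i + 1)).tsum_add
      ((summable_chainSeries (i + 1) (i + 1)).mul_left _)]
  congr 1
  funext k
  rw [evenPlusTail_step (k + i), add_assoc]
  ring

/-- The difference $C_{i,i+1}-C_{i+1,i+1}$ inserts a factor $1-X^{2k}$, which kills the term $k=0$.
After the shift $k\mapsto k+1$ that factor is absorbed by `chainCoeff_step`, and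
$X^{2i+1}(1+X^{2k+1})=(1+X^{2(k+i+1)})+(X^{2i+1}-1)$ splits the result. -/
theorem chainSeries_succ (i : ℕ) :
    chainSeries i (i + 1) =
      (X ^ (2 * i + 1) - 1) * chainSeries (i + 1) (i + 2) + 2 * chainSeries (i + 1) (i + 1) := by
  have h1 : chainSeries i (i + 1) - chainSeries (i + 1) (i + 1) =
      ∑' k : ℕ, X ^ (k ^ 2 + 2 * i * k) *
        (((1 - X ^ (2 * k)) * chainCoeff k) * evenPlusTail (k + (i + 1))) := by
    unfold chainSeries
    rw [← (summable_chainSeries i (i + 1)).tsum_sub (summable_chainSeries (i + 1) (i + 1))]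
    congr 1
    funext k
    ring
  have h2 : chainSeries (i + 1) (i + 1) + (X ^ (2 * i + 1) - 1) * chainSeries (i + 1) (i + 2) =
      ∑' k : ℕ, X ^ ((k + 1) ^ 2 + 2 * i * (k + 1)) *
        (((1 - X ^ (2 * (k + 1))) * chainCoeff (k + 1)) * evenPlusTail (k + 1 + (i + 1))) := by
    unfold chainSeries
    rw [← (summable_chainSeries (i + 1) (i + 2)).tsum_mul_left,
      ← (summable_chainSeries (i + 1) (i + 1)).tsum_add
        ((summable_chainSeries (i + 1) (i + 2)).mul_left _)]
    congr 1
    funext k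
    rw [mul_add_one 2 k, chainCoeff_step, evenPlusTail_step (k + (i + 1)),
      show k + 1 + (i + 1) = k + (i + 2) by ring, show k + (i + 1) + 1 = k + (i + 2) by ring]
    ring
  rw [(summable_of_X_pow_dvd fun k =>
    Dvd.dvd.mul_right (X_pow_dvd_X_pow_sq k _) _).tsum_eq_zero_add, ← h2] at h1
  simp only [mul_zero, pow_zero, sub_self, zero_mul, zero_add] at h1
  linear_combination h1

theorem X_pow_dvd_chainSeries_sub_one {i j m : ℕ} (hj : m ≤ 2 * j) (hi : m ≤ 2 * i + 1) :
    X ^ m ∣ chainSeries i j - 1 := by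
  rw [chainSeries, (summable_chainSeries i j).tsum_eq_zero_add]
  have h0 : X ^ m ∣ evenPlusTail j - 1 :=
    X_pow_dvd_qPoch_sub_one X_dvd_X_sq (Dvd.dvd.neg_right (pow_dvd_pow X hj))
  have h1 : X ^ m ∣ ∑' k : ℕ, X ^ ((k + 1) ^ 2 + 2 * i * (k + 1)) *
      (chainCoeff (k + 1) * evenPlusTail (k + 1 + j)) := by
    apply X_pow_dvd_tsum ((summable_nat_add_iff 1).2 (summable_chainSeries i j))
    intro k
    exact Dvd.dvd.mul_right (pow_dvd_pow X (by nlinarith)) _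
  rw [add_sub_right_comm]
  refine dvd_add ?_ h1
  simpa [chainCoeff_zero] using h0

/-- This is the evaluation $1/(X^4;X^4)_n$ in the form needed for `chainSeries`; the induction uses
$1-X^{4n+4}=(1-X^{2n+2})(1+X^{2n+2})$. -/
theorem symmSum_two_mul_evenPlusTail (n : ℕ) :
    symmSum X 2 (invPoch X) n * evenPlusTail 1 = invPoch X n * evenPlusTail (n + 1) := by
  induction n with
  | zero => simp [symmSum, invPoch_zero (q := X) dvd_rfl]
  | succ n ih =>
    apply (isUnit_one_sub_pow (q := X) dvd_rfl (show 0 < 4 * n + 4 by omega)).mul_left_cancel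
    rw [← mul_assoc, ← symmSum_two_step (isInvPoch_invPoch dvd_rfl), ih,
      isInvPoch_invPoch (q := X) dvd_rfl n, evenPlusTail_step (n + 1),
      show (2 * ((n : ℤ) + 1)).toNat = 2 * n + 2 by omega]
    push_cast
    ring

theorem X_pow_dvd_tsum_sub_sum {f : ℕ → PowerSeries ℤ} (h : ∀ n, X ^ n ∣ f n) (N : ℕ) :
    X ^ N ∣ ∑' n, f n - ∑ n ∈ Finset.range (N + 1), f n := by
  have hs := summable_of_X_pow_dvd h
  rw [← hs.sum_add_tsum_nat_add (N + 1), add_sub_cancel_left]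
  exact X_pow_dvd_tsum ((summable_nat_add_iff (N + 1)).2 hs) fun n =>
    (pow_dvd_pow X (by omega)).trans (h _)

/-- The Bailey transform evaluates the sum `S`, and $(-X^2;X^2)_\infty S$ is $C_{0,1}$. The
remaining products combine by $(-X;X^2)_\infty(-X^2;X^2)_\infty=(-X;X)_\infty$ and
$(X;X)_\infty(-X;X)_\infty=(X^2;X^2)_\infty$. -/
theorem chainSeries_zero_one_mul_qPoch :
    chainSeries 0 1 * qPoch X X = qPoch (X ^ 3) (X ^ 6) ^ 2 * qPoch (X ^ 6) (X ^ 6) := by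
  have hX2 := X_dvd_X_sq
  have hu : IsUnit (qPoch (X ^ 2) (X ^ 2)) := isUnit_qPoch hX2 hX2
  set S : PowerSeries ℤ :=
    ∑' k : ℕ, oddPlusProd X k * X ^ (k ^ 2) * symmSum X 2 (invPoch X) k with hS
  have hd : ∀ k : ℕ, (X : PowerSeries ℤ) ^ k ∣
      oddPlusProd X k * X ^ (k ^ 2) * symmSum X 2 (invPoch X) k := fun k =>
    Dvd.dvd.mul_right (Dvd.dvd.mul_left (by simpa using X_pow_dvd_X_pow_sq k 0) _) _
  have h1 : chainSeries 0 1 = evenPlusTail 1 * S := by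
    rw [hS, ← (summable_of_X_pow_dvd hd).tsum_mul_left, chainSeries]
    congr 1
    funext k
    rw [chainCoeff]
    linear_combination (-(X ^ k ^ 2 * oddPlusProd X k)) * symmSum_two_mul_evenPlusTail k
  have h2 : qPoch (X ^ 2) (X ^ 2) * S =
      qPoch (-X) (X ^ 2) * (qPoch (X ^ 3) (X ^ 6) ^ 2 * qPoch (X ^ 6) (X ^ 6)) := by
    apply eq_of_X_pow_dvd_sub
    intro N
    have h3 := X_pow_dvd_sum_symmSum_two_sub (q := X) dvd_rfl N
    have h4 := X_pow_dvd_thetaSum_one_sub (q := X ^ 3) (dvd_pow_self X (by norm_num)) N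
    -- Gauss's identity in base $X^3$ concerns exactly the partial theta sum left by the Bailey
    -- transform, so the two congruences can be added.
    have h5 : thetaSum (X ^ 3) 1 N = thetaSum X 3 N := by
      unfold thetaSum
      refine Finset.sum_congr rfl fun r _ => ?_
      rw [← pow_mul, one_mul]
    rw [h5, show ((X : PowerSeries ℤ) ^ 3) ^ 2 = X ^ 6 by ring] at h4
    have h6 := X_pow_dvd_tsum_sub_sum hd N
    rw [← hS] at h6
    convert dvd_add (dvd_add (Dvd.dvd.mul_left h6 (qPoch (X ^ 2) (X ^ 2))) h3)
      (Dvd.dvd.mul_left h4 (qPoch (-X) (X ^ 2))) using 1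
    ring
  have h3 := qPoch_even_mul_odd (q := X) dvd_rfl (-X)
  have h4 := qPoch_mul_qPoch_neg (q := X) dvd_rfl X
  have h5 : evenPlusTail 1 = qPoch (-X * X) (X ^ 2) := by
    unfold evenPlusTail
    congr 1
    ring
  apply hu.mul_left_cancel
  rw [h1, h5]
  linear_combination qPoch (-X * X) (X ^ 2) * qPoch X X * h2 +
    qPoch X X * (qPoch (X ^ 3) (X ^ 6) ^ 2 * qPoch (X ^ 6) (X ^ 6)) * h3 +
    (qPoch (X ^ 3) (X ^ 6) ^ 2 * qPoch (X ^ 6) (X ^ 6)) * h4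

end ChainSeries

/-! ### The coupled recurrences, on the analytic side. -/

section GapSeries

/-- The weighted generating function of the Rogers–Ramanujan partitions with parts at least `m`. -/
noncomputable def gapSeries (m : ℕ) : PowerSeries ℤ :=
  if Even m then chainSeries (m / 2) (m / 2 + 1) +
    2 * X ^ m * chainSeries (m / 2 + 1) (m / 2 + 1)
  else chainSeries (m / 2) (m / 2 + 1)

/-- The variant of `gapSeries` in which a chain starting at `m` has weight one. -/
noncomputable def gapSeriesFree (m : ℕ) : PowerSeries ℤ :=
  if Even m then chainSeries (m / 2) (m / 2) else chainSeries (m / 2) (m / 2 + 1)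

/-- The analytic counterpart of `gapPoly_step`. For even $m$ it is built into the definitions; for
odd $m$ it combines both contiguous relations. -/
theorem gapSeries_step (m : ℕ) :
    gapSeries m = gapSeries (m + 1) + (if Even m then 2 else 1) * X ^ m * gapSeriesFree (m + 2) := by
  rcases Nat.even_or_odd' m with ⟨i, rfl | rfl⟩
  · have e1 : (2 * i + 1) / 2 = i := by omega
    have e2 : (2 * i + 2) / 2 = i + 1 := by omega
    have e3 : ¬ Even (2 * i + 1) := by simp
    have e4 : Even (2 * i + 2) := ⟨i + 1, by ring⟩
    simp [gapSeries, gapSeriesFree, e1, e2, e3, e4]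
  · have e1 : (2 * i + 1) / 2 = i := by omega
    have e2 : (2 * i + 1 + 1) / 2 = i + 1 := by omega
    have e5 : (2 * i + 1 + 2) / 2 = i + 1 := by omega
    have e3 : ¬ Even (2 * i + 1) := by simp
    have e4 : Even (2 * i + 1 + 1) := ⟨i + 1, by ring⟩
    have e6 : ¬ Even (2 * i + 1 + 2) := by rw [Nat.not_even_iff_odd]; exact ⟨i + 1, by ring⟩
    simp only [gapSeries, gapSeriesFree, e1, e2, e3, e4, e5, e6, if_true, if_false]
    have h1 := chainSeries_succ i
    have h2 := chainSeries_self (i + 1)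
    linear_combination h1 + 2 * h2

theorem gapSeriesFree_step (m : ℕ) :
    gapSeriesFree m = gapSeries (m + 1) + X ^ m * gapSeriesFree (m + 2) := by
  rcases Nat.even_or_odd m with h | h
  · obtain ⟨i, rfl⟩ := even_iff_exists_two_mul.1 h
    have e1 : (2 * i + 1) / 2 = i := by omega
    have e2 : (2 * i + 2) / 2 = i + 1 := by omega
    have e3 : ¬ Even (2 * i + 1) := by simp
    have e4 : Even (2 * i + 2) := ⟨i + 1, by ring⟩
    simp [gapSeries, gapSeriesFree, e1, e2, e3, e4, chainSeries_self i]
  · have h1 := gapSeries_step m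
    rw [← Nat.not_even_iff_odd] at h
    have h2 : gapSeriesFree m = gapSeries m := by simp [gapSeries, gapSeriesFree, h]
    rw [h2, h1, if_neg h, one_mul]

theorem X_pow_dvd_gapSeries_sub_one (m : ℕ) : X ^ m ∣ gapSeries m - 1 := by
  unfold gapSeries
  split_ifs with h
  · rw [add_sub_right_comm]
    refine dvd_add (X_pow_dvd_chainSeries_sub_one (by omega) (by omega)) ?_
    exact ⟨2 * chainSeries (m / 2 + 1) (m / 2 + 1), by ring⟩
  · exact X_pow_dvd_chainSeries_sub_one (by omega) (by omega)

theorem X_pow_dvd_gapSeriesFree_sub_one (m : ℕ) : X ^ m ∣ gapSeriesFree m - 1 := by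
  unfold gapSeriesFree
  split_ifs with h
  · obtain ⟨i, rfl⟩ := even_iff_exists_two_mul.1 h
    exact X_pow_dvd_chainSeries_sub_one (by omega) (by omega)
  · exact X_pow_dvd_chainSeries_sub_one (by omega) (by omega)

theorem gapSeries_one_mul_qPoch :
    gapSeries 1 * qPoch X X = qPoch (X ^ 3) (X ^ 6) ^ 2 * qPoch (X ^ 6) (X ^ 6) := by
  rw [← chainSeries_zero_one_mul_qPoch]
  simp [gapSeries]

end GapSeries

/-! ### The same recurrences for sets of integers with gaps at least $2$. -/

section GapSets

/-- The sets of integers in `[m, T)` whose elements differ pairwise by at least `2`. -/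
def gapSets (m T : ℕ) : Finset (Finset ℕ) :=
  (Finset.Ico m T).powerset.filter fun S => ∀ a ∈ S, ∀ b ∈ S, a < b → a + 2 ≤ b

/-- The even elements `a` of `S`, other than `m`, with `a - 2 ∉ S`. -/
def evenStartsExcept (m : ℕ) (S : Finset ℕ) : Finset ℕ :=
  S.filter fun a => Even a ∧ a ≠ m ∧ ∀ b ∈ S, b + 2 ≠ a

/-- The even elements `a` of `S` with `a - 2 ∉ S`. -/
def evenStarts (S : Finset ℕ) : Finset ℕ :=
  S.filter fun a => Even a ∧ ∀ b ∈ S, b + 2 ≠ a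

theorem mem_gapSets {m T : ℕ} {S : Finset ℕ} : S ∈ gapSets m T ↔
    (∀ a ∈ S, m ≤ a ∧ a < T) ∧ ∀ a ∈ S, ∀ b ∈ S, a < b → a + 2 ≤ b := by
  simp [gapSets, Finset.subset_iff]

theorem gapSets_of_le {m T : ℕ} (h : T ≤ m) : gapSets m T = {∅} := by
  ext S
  rw [mem_gapSets, Finset.mem_singleton]
  constructor
  · rintro ⟨h1, -⟩
    rw [Finset.eq_empty_iff_forall_notMem]
    intro a ha
    have := h1 a ha
    omega
  · rintro rfl
    simp

theorem gapSets_eq_union {m T : ℕ} (h : m < T) :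
    gapSets m T = gapSets (m + 1) T ∪ (gapSets (m + 2) T).image (insert m) := by
  ext S
  simp only [Finset.mem_union, Finset.mem_image, mem_gapSets]
  constructor
  · rintro ⟨h1, h2⟩
    by_cases hm : m ∈ S
    · right
      refine ⟨S.erase m, ⟨?_, ?_⟩, Finset.insert_erase hm⟩
      · intro a ha
        rw [Finset.mem_erase] at ha
        have h3 := h1 a ha.2
        have h4 := h2 m hm a ha.2 (by omega)
        exact ⟨h4, h3.2⟩
      · intro a ha b hb
        exact h2 a (Finset.mem_of_mem_erase ha) b (Finset.mem_of_mem_erase hb)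
    · left
      refine ⟨fun a ha => ?_, h2⟩
      have h3 := h1 a ha
      have : a ≠ m := fun h => hm (h ▸ ha)
      omega
  · rintro (⟨h1, h2⟩ | ⟨S, ⟨h1, h2⟩, rfl⟩)
    · refine ⟨fun a ha => ?_, h2⟩
      have := h1 a ha
      omega
    · constructor
      · intro a ha
        rcases Finset.mem_insert.1 ha with rfl | ha
        · omega
        · have := h1 a ha
          omega
      · intro a ha b hb hab
        rcases Finset.mem_insert.1 ha with h3 | h3 <;> rcases Finset.mem_insert.1 hb with h4 | h4
        · omega
        · rw [h3]
          exact (h1 b h4).1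
        · have := h1 a h3
          omega
        · exact h2 a h3 b h4 hab

theorem sum_gapSets_step {M : Type*} [AddCommMonoid M] {m T : ℕ} (h : m < T)
    (f : Finset ℕ → M) :
    ∑ S ∈ gapSets m T, f S =
      ∑ S ∈ gapSets (m + 1) T, f S + ∑ S ∈ gapSets (m + 2) T, f (insert m S) := by
  have hn : ∀ k, m < k → ∀ S ∈ gapSets k T, m ∉ S := by
    intro k hk S hS hm
    have := (mem_gapSets.1 hS).1 m hm
    omega
  rw [gapSets_eq_union h, Finset.sum_union, Finset.sum_image]
  · intro S hS S' hS' hSS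
    have h1 := hn _ (by omega) S hS
    have h2 := hn _ (by omega) S' hS'
    rw [← Finset.erase_insert h1, ← Finset.erase_insert h2]
    exact congrArg (fun s => Finset.erase s m) hSS
  · rw [Finset.disjoint_left]
    intro S hS hS'
    obtain ⟨S', -, rfl⟩ := Finset.mem_image.1 hS'
    exact hn _ (by omega) _ hS (Finset.mem_insert_self _ _)

/-- Once $m$ is present, $m+2$ continues its chain instead of starting one; hence the excluded value
moves from $m$ to $m+2$. -/
theorem evenStartsExcept_insert {m T : ℕ} {S : Finset ℕ} (hS : S ∈ gapSets (m + 2) T) :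
    evenStartsExcept m (insert m S) = evenStartsExcept (m + 2) S := by
  have h1 := (mem_gapSets.1 hS).1
  ext a
  simp only [evenStartsExcept, Finset.mem_filter, Finset.mem_insert, forall_eq_or_imp]
  constructor
  · rintro ⟨rfl | ha, h2, h3, h4, h5⟩
    · exact absurd rfl h3
    · exact ⟨ha, h2, fun h => h4 h.symm, h5⟩
  · rintro ⟨ha, h2, h3, h4⟩
    have := h1 a ha
    exact ⟨Or.inr ha, h2, by omega, fun h => h3 h.symm, h4⟩

theorem card_evenStarts_insert {m T : ℕ} {S : Finset ℕ} (hS : S ∈ gapSets (m + 2) T) :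
    (evenStarts (insert m S)).card =
      (evenStartsExcept (m + 2) S).card + if Even m then 1 else 0 := by
  have h1 := (mem_gapSets.1 hS).1
  have hm : m ∉ evenStartsExcept (m + 2) S := by
    intro hm
    have := h1 m (Finset.mem_of_mem_filter _ hm)
    omega
  have hmem : ∀ a, a ∈ evenStarts (insert m S) ↔
      a ∈ evenStartsExcept (m + 2) S ∨ (a = m ∧ Even m) := by
    intro a
    simp only [evenStarts, evenStartsExcept, Finset.mem_filter, Finset.mem_insert,
      forall_eq_or_imp]
    constructor
    · rintro ⟨rfl | ha, h2, h4, h5⟩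
      · exact Or.inr ⟨rfl, h2⟩
      · exact Or.inl ⟨ha, h2, fun h => h4 h.symm, h5⟩
    · rintro (⟨ha, h2, h3, h4⟩ | ⟨rfl, h2⟩)
      · exact ⟨Or.inr ha, h2, fun h => h3 h.symm, h4⟩
      · refine ⟨Or.inl rfl, h2, by omega, fun b hb => ?_⟩
        have := h1 b hb
        omega
  split_ifs with he
  · rw [← Finset.card_insert_of_notMem hm]
    congr 1
    ext a
    rw [hmem, Finset.mem_insert, or_comm]
    simp [he]
  · rw [add_zero]
    congr 1
    ext a
    rw [hmem]
    simp [he]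

theorem evenStartsExcept_eq {m T : ℕ} {S : Finset ℕ} (hS : S ∈ gapSets (m + 1) T) :
    evenStartsExcept m S = evenStarts S := by
  refine Finset.filter_congr fun a ha => ?_
  have := (mem_gapSets.1 hS).1 a ha
  have h : a ≠ m := by omega
  simp [h]

/-- The weighted generating polynomial of `gapSets m T`. -/
noncomputable def gapPoly (m T : ℕ) : PowerSeries ℤ :=
  ∑ S ∈ gapSets m T, 2 ^ (evenStarts S).card * X ^ (∑ a ∈ S, a)

/-- The variant of `gapPoly` in which `m` is not counted as the start of a chain. -/
noncomputable def gapPolyFree (m T : ℕ) : PowerSeries ℤ :=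
  ∑ S ∈ gapSets m T, 2 ^ (evenStartsExcept m S).card * X ^ (∑ a ∈ S, a)

theorem gapPoly_of_le {m T : ℕ} (h : T ≤ m) : gapPoly m T = 1 := by
  simp [gapPoly, gapSets_of_le h, evenStarts]

theorem gapPolyFree_of_le {m T : ℕ} (h : T ≤ m) : gapPolyFree m T = 1 := by
  simp [gapPolyFree, gapSets_of_le h, evenStartsExcept]

theorem sum_insert_of_mem_gapSets {m T : ℕ} {S : Finset ℕ} (hS : S ∈ gapSets (m + 2) T) :
    ∑ a ∈ insert m S, a = m + ∑ a ∈ S, a := by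
  rw [Finset.sum_insert]
  intro hm
  have := (mem_gapSets.1 hS).1 m hm
  omega

theorem gapPoly_step {m T : ℕ} (h : m < T) :
    gapPoly m T = gapPoly (m + 1) T + (if Even m then 2 else 1) * X ^ m * gapPolyFree (m + 2) T := by
  rw [gapPoly, sum_gapSets_step h, gapPoly, gapPolyFree, Finset.mul_sum]
  congr 1
  refine Finset.sum_congr rfl fun S hS => ?_
  rw [card_evenStarts_insert hS, sum_insert_of_mem_gapSets hS]
  split_ifs <;> ring

theorem gapPolyFree_step {m T : ℕ} (h : m < T) :
    gapPolyFree m T = gapPoly (m + 1) T + X ^ m * gapPolyFree (m + 2) T := by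
  rw [gapPolyFree, sum_gapSets_step h, gapPoly, gapPolyFree, Finset.mul_sum]
  congr 1
  · refine Finset.sum_congr rfl fun S hS => ?_
    rw [evenStartsExcept_eq hS]
  · refine Finset.sum_congr rfl fun S hS => ?_
    rw [evenStartsExcept_insert hS, sum_insert_of_mem_gapSets hS]
    ring

/-- Series and polynomials obey the same recurrences, and for $m\ge T$ all of them are $1$ modulo
$X^T$. The induction is downward in $m$, with `d` bounding the distance to `T`. -/
theorem X_pow_dvd_gapSeries_sub_gapPoly (T : ℕ) (d : ℕ) : ∀ m, T ≤ m + d →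
    X ^ T ∣ gapSeries m - gapPoly m T ∧ X ^ T ∣ gapSeriesFree m - gapPolyFree m T := by
  induction d using Nat.strong_induction_on with
  | _ d ih =>
    intro m hm
    rcases le_or_gt T m with h | h
    · rw [gapPoly_of_le h, gapPolyFree_of_le h]
      exact ⟨(pow_dvd_pow X h).trans (X_pow_dvd_gapSeries_sub_one m),
        (pow_dvd_pow X h).trans (X_pow_dvd_gapSeriesFree_sub_one m)⟩
    · have h1 := (ih (d - 1) (by omega) (m + 1) (by omega)).1
      have h2 := (ih (d - 1) (by omega) (m + 2) (by omega)).2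
      rw [gapPoly_step h, gapPolyFree_step h, gapSeries_step, gapSeriesFree_step m,
        add_sub_add_comm, add_sub_add_comm, ← mul_sub, ← mul_sub]
      exact ⟨dvd_add h1 (Dvd.dvd.mul_left h2 _), dvd_add h1 (Dvd.dvd.mul_left h2 _)⟩

end GapSets

/-! ### Even chains correspond to their first parts. -/

section Chains

theorem mem_stepTwoBlock {a l x : ℕ} : x ∈ stepTwoBlock a l ↔ ∃ i < l, a + 2 * i = x := by
  simp [stepTwoBlock]

theorem stepTwoBlock_subset {a l l' : ℕ} (h : l ≤ l') : stepTwoBlock a l ⊆ stepTwoBlock a l' := by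
  intro x hx
  rw [mem_stepTwoBlock] at hx ⊢
  obtain ⟨i, hi, rfl⟩ := hx
  exact ⟨i, by omega, rfl⟩

theorem eq_of_stepTwoBlock_eq {a b l l' : ℕ} (hl : 1 ≤ l) (hl' : 1 ≤ l')
    (h : stepTwoBlock a l = stepTwoBlock b l') : a = b := by
  have h1 : a ∈ stepTwoBlock b l' := h ▸ mem_stepTwoBlock.2 ⟨0, hl, by simp⟩
  have h2 : b ∈ stepTwoBlock a l := h ▸ mem_stepTwoBlock.2 ⟨0, hl', by simp⟩
  obtain ⟨i, -, h1⟩ := mem_stepTwoBlock.1 h1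
  obtain ⟨j, -, h2⟩ := mem_stepTwoBlock.1 h2
  omega

variable {n : ℕ} (p : n.Partition)

/-- Every part `a` with `a - 2` not a part starts a chain. -/
theorem exists_isChainOf {a : ℕ} (ha : a ∈ p.parts) (h : ∀ b ∈ p.parts, b + 2 ≠ a) :
    ∃ l, 1 ≤ l ∧ IsChainOf p (stepTwoBlock a l) := by
  classical
  set s := p.parts.toFinset with hs
  -- A block of length $l$ has $l$ distinct elements; this bound lets `Nat.findGreatest` pick the
  -- longest block starting at `a`.
  have hbound : ∀ l, stepTwoBlock a l ⊆ s → l ≤ s.card := by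
    intro l hl
    refine le_trans (le_of_eq ?_) (Finset.card_le_card hl)
    rw [stepTwoBlock, Finset.card_image_of_injective _ (fun i j hij => by simpa using hij),
      Finset.card_range]
  set l := Nat.findGreatest (fun l => stepTwoBlock a l ⊆ s) s.card with hl
  have h1 : stepTwoBlock a 1 ⊆ s := by
    intro x hx
    obtain ⟨i, hi, rfl⟩ := mem_stepTwoBlock.1 hx
    obtain rfl : i = 0 := by omega
    simpa [hs] using ha
  have hl1 : 1 ≤ l := Nat.le_findGreatest (hbound 1 h1) h1
  have hls : stepTwoBlock a l ⊆ s :=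
    Nat.findGreatest_spec (P := fun l => stepTwoBlock a l ⊆ s) (hbound 1 h1) h1
  refine ⟨l, hl1, ⟨hls, a, l, hl1, rfl⟩, ?_⟩
  rintro C ⟨hC, b, l', hl', rfl⟩ hsub
  have h2 : a ∈ stepTwoBlock b l' := hsub (mem_stepTwoBlock.2 ⟨0, hl1, by simp⟩)
  obtain ⟨i, hi, h3⟩ := mem_stepTwoBlock.1 h2
  -- Otherwise the larger block would contain $a-2$, which is not a part.
  have h4 : i = 0 := by
    by_contra h4
    have h5 : b + 2 * (i - 1) ∈ s := hC (mem_stepTwoBlock.2 ⟨i - 1, by omega, rfl⟩)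
    exact h _ (by simpa [hs] using h5) (by omega)
  obtain rfl : b = a := by omega
  exact stepTwoBlock_subset (Nat.le_findGreatest (hbound l' hC) hC)

/-- If $a-2$ were a part, prepending it would contradict maximality. -/
theorem isChainOf_start {a l : ℕ} (hl : 1 ≤ l) (h : IsChainOf p (stepTwoBlock a l)) :
    a ∈ p.parts ∧ ∀ b ∈ p.parts, b + 2 ≠ a := by
  have h1 : a ∈ stepTwoBlock a l := mem_stepTwoBlock.2 ⟨0, hl, by simp⟩
  refine ⟨by simpa using h.1.1 h1, ?_⟩
  rintro b hb rfl
  have h2 : IsBlockOf p (stepTwoBlock b (l + 1)) := by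
    refine ⟨?_, b, l + 1, by omega, rfl⟩
    intro x hx
    obtain ⟨i, hi, rfl⟩ := mem_stepTwoBlock.1 hx
    rcases Nat.eq_zero_or_pos i with rfl | h0
    · simpa using hb
    · exact h.1.1 (mem_stepTwoBlock.2 ⟨i - 1, by omega, by omega⟩)
  have h3 : stepTwoBlock (b + 2) l ⊆ stepTwoBlock b (l + 1) := by
    intro x hx
    obtain ⟨i, hi, rfl⟩ := mem_stepTwoBlock.1 hx
    exact mem_stepTwoBlock.2 ⟨i + 1, by omega, by ring⟩
  have h4 := h.2 h2 h3 (mem_stepTwoBlock.2 ⟨0, by omega, by simp⟩ : b ∈ _)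
  obtain ⟨i, -, h5⟩ := mem_stepTwoBlock.1 h4
  omega

theorem forall_even_stepTwoBlock {a l : ℕ} (hl : 1 ≤ l) :
    (∀ m ∈ stepTwoBlock a l, Even m) ↔ Even a := by
  constructor
  · intro h
    exact h a (mem_stepTwoBlock.2 ⟨0, hl, by simp⟩)
  · intro h m hm
    obtain ⟨i, -, rfl⟩ := mem_stepTwoBlock.1 hm
    exact h.add (even_two_mul i)

theorem mem_chains {C : Finset ℕ} : C ∈ chains p ↔ IsChainOf p C := by
  simp only [chains, Finset.mem_filter, Finset.mem_powerset, and_iff_right_iff_imp]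
  exact fun h => h.1.1

/-- A chain is determined by its first element: two blocks with the same start are nested, so
maximality makes them equal. -/
theorem numEvenChains_eq : numEvenChains p = (evenStarts p.parts.toFinset).card := by
  classical
  have hex : ∀ a, a ∈ evenStarts p.parts.toFinset →
      ∃ l, 1 ≤ l ∧ IsChainOf p (stepTwoBlock a l) := by
    intro a ha
    simp only [evenStarts, Finset.mem_filter, Multiset.mem_toFinset] at ha
    exact exists_isChainOf p ha.1 ha.2.2
  choose len hlen hchain using hex
  rw [numEvenChains, eq_comm]
  refine Finset.card_bij (fun a ha => stepTwoBlock a (len a ha)) ?_ ?_ ?_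
  · intro a ha
    rw [Finset.mem_filter, mem_chains, forall_even_stepTwoBlock (hlen a ha)]
    exact ⟨hchain a ha, (Finset.mem_filter.1 ha).2.1⟩
  · intro a ha b hb hab
    exact eq_of_stepTwoBlock_eq (hlen a ha) (hlen b hb) hab
  · intro C hC
    rw [Finset.mem_filter, mem_chains] at hC
    obtain ⟨hC, he⟩ := hC
    obtain ⟨-, a, l, hl, rfl⟩ := hC.1
    rw [forall_even_stepTwoBlock hl] at he
    have h1 := isChainOf_start p hl hC
    have ha : a ∈ evenStarts p.parts.toFinset := by
      simpa [evenStarts, h1.1, he] using h1.2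
    refine ⟨a, ha, ?_⟩
    rcases le_total (len a ha) l with h | h
    · exact Maximal.eq_of_le (P := IsBlockOf p) (hchain a ha) hC.1 (stepTwoBlock_subset h)
    · exact (Maximal.eq_of_le (P := IsBlockOf p) hC (hchain a ha).1 (stepTwoBlock_subset h)).symm

/-- The weighted sum over Rogers–Ramanujan partitions as a coefficient. -/
theorem sum_rogersRamanujanPartitions (n : ℕ) :
    ∑ p ∈ rogersRamanujanPartitions n, (2 : ℤ) ^ numEvenChains p =
      PowerSeries.coeff n (gapPoly 1 (n + 1)) := by
  classical
  have h2 : ∀ S : Finset ℕ, PowerSeries.coeff n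
      (2 ^ (evenStarts S).card * X ^ (∑ a ∈ S, a) : PowerSeries ℤ) =
      if ∑ a ∈ S, a = n then 2 ^ (evenStarts S).card else 0 := by
    intro S
    have : (2 ^ (evenStarts S).card : PowerSeries ℤ) = PowerSeries.C (2 ^ (evenStarts S).card) := by
      simp
    rw [this, PowerSeries.coeff_C_mul, PowerSeries.coeff_X_pow]
    simp [eq_comm]
  rw [gapPoly, map_sum, Finset.sum_congr rfl fun S _ => h2 S, ← Finset.sum_filter]
  refine Finset.sum_bij (fun p _ => p.parts.toFinset) ?_ ?_ ?_ ?_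
  · intro p hp
    simp only [rogersRamanujanPartitions, Finset.mem_filter, Finset.mem_univ, true_and] at hp
    rw [Finset.mem_filter, mem_gapSets]
    refine ⟨⟨fun a ha => ?_, fun a ha b hb => ?_⟩, ?_⟩
    · rw [Multiset.mem_toFinset] at ha
      exact ⟨p.parts_pos ha, Nat.lt_succ_of_le (p.le_of_mem_parts ha)⟩
    · rw [Multiset.mem_toFinset] at ha hb
      exact hp.2 a ha b hb
    · rw [Finset.sum, Multiset.toFinset_val, hp.1.dedup, Multiset.map_id', p.parts_sum]
  · intro p hp p' hp' h
    simp only [rogersRamanujanPartitions, Finset.mem_filter, Finset.mem_univ, true_and] at hp hp'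
    ext1
    have h3 := congrArg Finset.val h
    rwa [Multiset.toFinset_val, Multiset.toFinset_val, hp.1.dedup, hp'.1.dedup] at h3
  · intro S hS
    rw [Finset.mem_filter, mem_gapSets] at hS
    obtain ⟨⟨h3, h4⟩, h5⟩ := hS
    refine ⟨⟨S.val, fun {a} ha => (h3 a ha).1, by rw [← h5, Finset.sum, Multiset.map_id']⟩, ?_, ?_⟩
    · simp only [rogersRamanujanPartitions, Finset.mem_filter, Finset.mem_univ, true_and]
      exact ⟨S.nodup, h4⟩
    · simp
  · intro p _
    rw [numEvenChains_eq]

theorem sum_rogersRamanujanPartitions_eq_coeff_gapSeries (n : ℕ) :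
    ∑ p ∈ rogersRamanujanPartitions n, (2 : ℤ) ^ numEvenChains p =
      PowerSeries.coeff n (gapSeries 1) := by
  have h := (X_pow_dvd_gapSeries_sub_gapPoly (n + 1) n 1 (by omega)).1
  have h1 := PowerSeries.X_pow_dvd_iff.1 h n n.lt_succ_self
  rw [map_sub, sub_eq_zero] at h1
  rw [sum_rogersRamanujanPartitions, h1]

end Chains

/-! ### The signed partition generating function as a product. -/

section SignedPartitions

/-- The sign `-1` at multiples of three and `1` elsewhere. -/
def threeSign (i : ℕ) : ℤ := if 3 ∣ i then -1 else 1

theorem neg_one_pow_numMultiplesOfThree {n : ℕ} (p : n.Partition) :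
    (-1 : ℤ) ^ numMultiplesOfThree p = p.parts.toFinsupp.prod fun i c => threeSign i ^ c := by
  have h : ∀ s : Multiset ℕ, (-1 : ℤ) ^ (s.countP fun m => 3 ∣ m) = (s.map threeSign).prod := by
    intro s
    induction s using Multiset.induction_on with
    | empty => simp
    | cons a s ih =>
      rw [Multiset.countP_cons, Multiset.map_cons, Multiset.prod_cons, ← ih, pow_add, threeSign]
      split_ifs <;> simp
  rw [numMultiplesOfThree, h, Finset.prod_multiset_map_count, Finsupp.prod]
  simp

theorem X_pow_dvd_threeSign_mul (i : ℕ) :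
    (X : PowerSeries ℤ) ^ i ∣ 1 - PowerSeries.C (threeSign (i + 1)) * X ^ (i + 1) - 1 :=
  ⟨-(PowerSeries.C (threeSign (i + 1)) * X), by ring⟩

/-- Factor by factor, a geometric series times $1-y$ is $1$. -/
theorem genFun_threeSign_mul_tprod :
    Nat.Partition.genFun (fun i c => threeSign i ^ c) *
      ∏' i : ℕ, (1 - PowerSeries.C (threeSign (i + 1)) * X ^ (i + 1)) = 1 := by
  have hG := Nat.Partition.hasProd_genFun fun i c => threeSign i ^ c
  simp only [PowerSeries.smul_eq_C_mul] at hG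
  rw [← hG.tprod_eq, ← hG.multipliable.tprod_mul
    (multipliable_of_X_pow_dvd X_pow_dvd_threeSign_mul)]
  convert tprod_one with i
  set y : PowerSeries ℤ := PowerSeries.C (threeSign (i + 1)) * X ^ (i + 1) with hy
  have hc : PowerSeries.constantCoeff y = 0 := by simp [hy]
  have h1 : ∀ j : ℕ, PowerSeries.C (threeSign (i + 1) ^ (j + 1)) * X ^ ((i + 1) * (j + 1)) =
      y ^ (j + 1) := by
    intro j
    rw [hy, mul_pow, ← pow_mul, map_pow]
  simp only [h1]
  have hs := summable_pow_of_constantCoeff_eq_zero hc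
  have h2 := tsum_pow_mul_one_sub_of_constantCoeff_eq_zero hc
  rw [hs.tsum_eq_zero_add, pow_zero] at h2
  exact h2

theorem tprod_ite_three_dvd (f : ℕ → PowerSeries ℤ) :
    ∏' i : ℕ, (if 3 ∣ i + 1 then f (i + 1) else 1) = ∏' k : ℕ, f (3 * (k + 1)) := by
  -- The product is indexed by $i$ with part size $i+1$, so multiples of three $3(k+1)$ sit at
  -- $i=3k+2$.
  have hg : Function.Injective fun k : ℕ => 3 * k + 2 := fun a b h => by
    simp only at h
    omega
  rw [← hg.tprod_eq]
  · refine tprod_congr fun k => ?_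
    rw [if_pos ⟨k + 1, by ring⟩]
    congr 1
  · intro i hi
    by_contra hn
    apply hi
    apply if_neg
    rintro ⟨k, hk⟩
    exact hn ⟨k - 1, by simp only; omega⟩

theorem qPoch_self_eq (y : PowerSeries ℤ) (e : ℕ) :
    qPoch (y * X ^ e) (X ^ e) = ∏' k : ℕ, (1 - y * X ^ (e * (k + 1))) := by
  refine tprod_congr fun k => ?_
  ring

/-- Compared factorwise: for $3\mid i$ both sides contribute $(1+X^i)(1-X^i)$, and otherwise
$1-X^i$. -/
theorem tprod_threeSign_mul :
    (∏' i : ℕ, (1 - PowerSeries.C (threeSign (i + 1)) * X ^ (i + 1))) *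
      qPoch (X ^ 3) (X ^ 3) = qPoch X X * qPoch (-X ^ 3) (X ^ 3) := by
  have hm : ∀ y : PowerSeries ℤ, Multipliable fun i : ℕ =>
      if 3 ∣ i + 1 then 1 - y * X ^ (i + 1) else 1 := by
    intro y
    apply multipliable_of_X_pow_dvd
    intro n
    split_ifs
    · exact ⟨-(y * X), by ring⟩
    · simp
  have h3 : ∀ y : PowerSeries ℤ, qPoch (y * X ^ 3) (X ^ 3) =
      ∏' i : ℕ, (if 3 ∣ i + 1 then 1 - y * X ^ (i + 1) else 1) := by
    intro y
    rw [qPoch_self_eq, tprod_ite_three_dvd fun i => 1 - y * X ^ i]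
  have h4 := h3 1
  have h5 := h3 (-1)
  rw [one_mul] at h4
  rw [neg_one_mul] at h5
  rw [h4, h5, qPoch, ← (multipliable_of_X_pow_dvd X_pow_dvd_threeSign_mul).tprod_mul (hm 1),
    ← (multipliable_qPoch dvd_rfl X).tprod_mul (hm (-1))]
  refine tprod_congr fun i => ?_
  rw [threeSign]
  split_ifs
  · simp only [map_neg, map_one]
    ring
  · simp only [map_one]
    ring

theorem genFun_threeSign_eq_gapSeries :
    Nat.Partition.genFun (fun i c => threeSign i ^ c) = gapSeries 1 := by
  have hX : ∀ {n : ℕ}, n ≠ 0 → (X : PowerSeries ℤ) ∣ X ^ n := fun h => dvd_pow_self X h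
  have h3 := hX (n := 3) (by norm_num)
  have h1 := genFun_threeSign_mul_tprod
  have h2 := tprod_threeSign_mul
  have h4 := qPoch_even_mul_odd h3 (X ^ 3)
  have h5 := qPoch_mul_qPoch_neg h3 (X ^ 3)
  rw [show (X : PowerSeries ℤ) ^ 3 * X ^ 3 = X ^ 6 by ring,
    show ((X : PowerSeries ℤ) ^ 3) ^ 2 = X ^ 6 by ring] at h4
  rw [show ((X : PowerSeries ℤ) ^ 3) ^ 2 = X ^ 6 by ring] at h5
  have h6 := gapSeries_one_mul_qPoch
  have hu3 : IsUnit (qPoch (X ^ 3) (X ^ 3)) := isUnit_qPoch h3 h3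
  have hu6 : IsUnit (qPoch (X ^ 6) (X ^ 6)) :=
    isUnit_qPoch (hX (by norm_num)) (hX (by norm_num))
  set V := ∏' i : ℕ, (1 - PowerSeries.C (threeSign (i + 1)) * X ^ (i + 1))
  set a3 := qPoch (X ^ 3) (X ^ 3)
  set b6 := qPoch (X ^ 6) (X ^ 6)
  set o3 := qPoch (X ^ 3) (X ^ 6)
  set e3 := qPoch (-X ^ 3) (X ^ 3)
  -- Euler's odd–distinct identity in base $X^3$.
  have h7 : o3 * e3 = 1 := by
    apply hu6.mul_left_cancel
    linear_combination e3 * h4 + h5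
  have h8 : gapSeries 1 * V = 1 := by
    apply hu3.mul_left_cancel
    linear_combination gapSeries 1 * h2 + e3 * h6 + o3 * b6 * h7 + h4
  -- Both series are inverse to `V`, hence equal.
  linear_combination gapSeries 1 * h1 -
    Nat.Partition.genFun (fun i c => threeSign i ^ c) * h8

end SignedPartitions

theorem theorem4 (n : ℕ) :
    ∑ p : n.Partition, (-1 : ℤ) ^ numMultiplesOfThree p =
      ∑ p ∈ rogersRamanujanPartitions n, (2 : ℤ) ^ numEvenChains p := by
  rw [sum_rogersRamanujanPartitions_eq_coeff_gapSeries, ← genFun_threeSign_eq_gapSeries,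
    Nat.Partition.coeff_genFun]
  exact Finset.sum_congr rfl fun p _ => neg_one_pow_numMultiplesOfThree p
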